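/- Let $M$ be a finite monoid that is (von Neumann) regular, i.e. for every $s\in M$ there is $t\in M$ with $sts=s$, and aperiodic, i.e. for every idempotent $e\in M$ the group of units of the monoid $eMe$ (with identity $e$) is trivial; for example, every finite band (a finite monoid all of whose elements are idempotent) is such a monoid. Let $n$ be the number of $\mathscr J$-classes of $M$, that is, of classes of the equivalence relation $a\mathrel{\mathscr J}b\iff MaM=MbM$. Let $\mathbb ZM$ be the monoid ring of $M$ and regard $\mathbb Z$ as the trivial (left or right) $\mathbb ZM$-module, on which each element of $M$ acts as the identity. Then: 1. the left global dimension of $\mathbb ZM$ (the supremum of the projective dimensions of all left $\mathbb ZM$-modules) is finite; in fact $\mathrm{gl.dim}\,\mathbb ZM\le 3n-2$; 2. $H_k(M,\mathbb Z)=\mathrm{Tor}_k^{\mathbb ZM}(\mathbb Z,\mathbb Z)=0$ for all sufficiently large $k$; 3. the trivial left $\mathbb ZM$-module $\mathbb Z$ has a projective resolution of finite length all of whose terms are finitely generated projective $\mathbb ZM$-modules. -/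

import Mathlib

open CategoryTheory
open scoped TensorProduct

universe u v w

namespace MonoidGlobalDim

section Monoid

/-- A monoid is (von Neumann) regular if every `s` satisfies `s * t * s = s` for some `t`. -/
def IsRegularMonoid (M : Type u) [Monoid M] : Prop :=
  ∀ s : M, ∃ t : M, s * t * s = s

/-- The local submonoid `eMe` at an idempotent `e`. -/
def LocalMonoid {M : Type u} [Monoid M] {e : M} (_ : IsIdempotentElem e) : Type u :=
  Subsemigroup.corner e

/-- `eMe` is a monoid with the multiplication of `M` and with identity `e`. -/
instance {M : Type u} [Monoid M] {e : M} (he : IsIdempotentElem e) : Monoid (LocalMonoid he) where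
  __ := (inferInstance : Semigroup (Subsemigroup.corner e))
  one := ⟨e, e, by simp_rw [he.eq]⟩
  one_mul r := Subtype.ext ((Subsemigroup.mem_corner_iff he).mp r.2).1
  mul_one r := Subtype.ext ((Subsemigroup.mem_corner_iff he).mp r.2).2

/-- The maximal subgroup `G_e` at the idempotent `e`: the group of units of `eMe`. -/
abbrev MaximalSubgroup {M : Type u} [Monoid M] {e : M} (he : IsIdempotentElem e) : Type u :=
  (LocalMonoid he)ˣ

/-- A monoid is aperiodic if all its maximal subgroups are trivial. -/
def IsAperiodicMonoid (M : Type u) [Monoid M] : Prop :=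
  ∀ (e : M) (he : IsIdempotentElem e), Subsingleton (MaximalSubgroup he)

/-- The principal two-sided ideal `MaM`. -/
def principalIdeal {M : Type u} [Monoid M] (a : M) : Set M :=
  {x | ∃ s t : M, x = s * a * t}

/-- Green's relation `J`: `a` and `b` are related if `MaM = MbM`. -/
def greenJ (M : Type u) [Monoid M] : Setoid M :=
  Setoid.ker principalIdeal

/-- The number of `J`-classes of a (finite) monoid. -/
noncomputable def numJClasses (M : Type u) [Monoid M] : ℕ :=
  Nat.card (Quotient (greenJ M))

/-- A band (a monoid of idempotents) is regular. -/
theorem isRegularMonoid_of_band {M : Type u} [Monoid M] (h : ∀ x : M, x * x = x) :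
    IsRegularMonoid M :=
  fun s => ⟨s, by rw [h, h]⟩

/-- A band is aperiodic. -/
theorem isAperiodicMonoid_of_band {M : Type u} [Monoid M] (h : ∀ x : M, x * x = x) :
    IsAperiodicMonoid M := by
  intro e he
  have key : ∀ x : MaximalSubgroup he, x = 1 := fun x => by
    have hx : x * x = x := Units.ext (Subtype.ext (h _))
    exact mul_eq_left.mp hx
  exact ⟨fun x y => (key x).trans (key y).symm⟩

end Monoid

section GlobalDimension

/-- The left global dimension of a ring: the supremum of the projective dimensions of all left
modules (in the universe `v`). -/
noncomputable def globalDimension (R : Type u) [Ring R] : WithBot ℕ∞ :=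
  ⨆ A : ModuleCat.{v} R, projectiveDimension A

end GlobalDimension

section Tor

variable {R : Type u} [Ring R]

/-- The relations `b r ⊗ a = b ⊗ r a` that define `B ⊗_R A` as a quotient of `B ⊗_ℤ A`, for a right
`R`-module `B` (a left module over the opposite ring) and a left `R`-module `A`. -/
def balancedRelations (B : ModuleCat.{w} Rᵐᵒᵖ) (A : ModuleCat.{v} R) : Submodule ℤ (B ⊗[ℤ] A) :=
  Submodule.span ℤ
    {x | ∃ (b : B) (r : R) (a : A), x = (MulOpposite.op r • b) ⊗ₜ[ℤ] a - b ⊗ₜ[ℤ] (r • a)}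

/-- The abelian group `B ⊗_R A`, for a right `R`-module `B` and a left `R`-module `A`. -/
abbrev BalancedTensor (B : ModuleCat.{w} Rᵐᵒᵖ) (A : ModuleCat.{v} R) : Type (max w v) :=
  (B ⊗[ℤ] A) ⧸ balancedRelations B A

theorem balancedRelations_le_comap (B : ModuleCat.{w} Rᵐᵒᵖ) {A A' : ModuleCat.{v} R}
    (f : A ⟶ A') :
    balancedRelations B A ≤ (balancedRelations B A').comap
      (LinearMap.lTensor B f.hom.toAddMonoidHom.toIntLinearMap) := by
  refine Submodule.span_le.mpr ?_
  rintro _ ⟨b, r, a, rfl⟩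
  refine Submodule.subset_span ⟨b, r, f.hom a, ?_⟩
  simp

/-- The map `B ⊗_R f : B ⊗_R A → B ⊗_R A'`. -/
def balancedTensorMap (B : ModuleCat.{w} Rᵐᵒᵖ) {A A' : ModuleCat.{v} R} (f : A ⟶ A') :
    BalancedTensor B A →ₗ[ℤ] BalancedTensor B A' :=
  Submodule.mapQ _ _ (LinearMap.lTensor B f.hom.toAddMonoidHom.toIntLinearMap)
    (balancedRelations_le_comap B f)

/-- The functor `B ⊗_R -` from left `R`-modules to abelian groups. -/
def balancedTensorFunctor (B : ModuleCat.{w} Rᵐᵒᵖ) :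
    ModuleCat.{v} R ⥤ ModuleCat.{max w v} ℤ where
  obj A := ModuleCat.of ℤ (BalancedTensor B A)
  map f := ModuleCat.ofHom (balancedTensorMap B f)
  map_id A := by
    ext b a
    rfl
  map_comp f g := by
    ext b a
    rfl

instance (B : ModuleCat.{w} Rᵐᵒᵖ) : (balancedTensorFunctor.{u, v, w} B).Additive where
  map_add {A A' f g} := by
    have h : balancedTensorMap B (f + g) = balancedTensorMap B f + balancedTensorMap B g := by
      ext b a
      exact congrArg (Submodule.Quotient.mk (p := balancedRelations B A'))
        (TensorProduct.tmul_add b (f.hom a) (g.hom a))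
    exact congrArg ModuleCat.ofHom h

/-- `Tor_n^R(B, A)` for a right `R`-module `B` and a left `R`-module `A`: the value at `A` of the
`n`-th left derived functor of `B ⊗_R -`. -/
noncomputable def Tor (B : ModuleCat.{w} Rᵐᵒᵖ) (A : ModuleCat.{u} R) (n : ℕ) :
    ModuleCat.{max w u} ℤ :=
  ((balancedTensorFunctor.{u, u, w} B).leftDerived n).obj A

end Tor

section Homology

variable (M : Type u) [Monoid M]

/-- The augmentation `ℤM → ℤ`, sending every element of `M` to `1`. -/
noncomputable def augmentation : MonoidAlgebra ℤ M →+* ℤ :=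
  (MonoidAlgebra.lift ℤ ℤ M (1 : M →* ℤ)).toRingHom

/-- The trivial left `ℤM`-module `ℤ`, moved to the universe of `M`. -/
noncomputable def trivialModule : ModuleCat.{u} (MonoidAlgebra ℤ M) :=
  (ModuleCat.restrictScalars (augmentation M)).obj (ModuleCat.of ℤ (ULift.{u} ℤ))

/-- The trivial right `ℤM`-module `ℤ`. -/
noncomputable def trivialRightModule : ModuleCat.{0} (MonoidAlgebra ℤ M)ᵐᵒᵖ :=
  (ModuleCat.restrictScalars
    ((augmentation M).fromOpposite fun _ _ => Commute.all _ _)).obj (ModuleCat.of ℤ ℤ)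

/-- The homology `H_n(M, A) = Tor_n^{ℤM}(ℤ, A)` of `M` with coefficients in a left `ℤM`-module. -/
noncomputable def monoidHomology (A : ModuleCat.{u} (MonoidAlgebra ℤ M)) (n : ℕ) :
    ModuleCat.{u} ℤ :=
  Tor (trivialRightModule M) A n

end Homology

end MonoidGlobalDim

/-! Build a chain of ideals from `∅` to `M`, adjoining one J-class at a time, each minimal outside
the previous ideal `I`. By regularity the new class contains an idempotent `e`. Finiteness and
aperiodicity make `e` the only element of `eMe` outside `I`. Hence multiplication is a bijection
from `(Me \ I) × (eM \ I)` onto the new class (`IsMinimalOutside.mul_injective`, `classMul_exact`):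
these are Rees coordinates with trivial group.

Write `ℤX ⊗ W` for the `W`-valued functions on `X`, products leaving `X` counting as `0`. The
bijection gives a short exact sequence with sub `ℤ(Me \ I) ⊗ ℤ(eM \ I) ⊗ W`, middle `ℤ(M \ I) ⊗ W`
and quotient `ℤ(M \ I') ⊗ W`, where `I' = I ∪ MeM`. Right multiplication by `e` makes `ℤ(Me \ I) ⊗
W` a retract of `ℤ(M \ I) ⊗ W`, so each adjoined class raises the projective dimension by at most
one. For `I = ∅` it is at most one, since `ℤM ⊗ W` inherits a length-one resolution of `W` over `ℤ`.
This bounds `ℤ(Me \ I) ⊗ W` by the number of classes in `I`, plus one.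

For an arbitrary module `V` killed by `I`, compare `V` with `ℤ(Me \ I) ⊗ eV` through the action map.
Its kernel and cokernel are killed by `I'`, so induction on the number of classes outside the ideal
applies: the kernel costs one dimension per class. Starting from `I = ∅` this yields projective
dimension at most `2n - 1`, which is at most `3n - 2` because `n ≥ 1`.

As `ℤM` is left Noetherian, iterated finitely generated syzygies of the trivial module give the
finite resolution, and Tor vanishes beyond its length. -/

namespace MonoidGlobalDim

/-! ### Ideals, minimal J-classes and their Rees coordinates -/

section Ideals

variable {M : Type u} [Monoid M]

/-- A (possibly empty) two-sided ideal of a monoid. -/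
def IsIdealSet (I : Set M) : Prop :=
  ∀ a ∈ I, ∀ s t : M, s * a * t ∈ I

theorem IsIdealSet.mul_left {I : Set M} (hI : IsIdealSet I) {a : M} (ha : a ∈ I) (s : M) :
    s * a ∈ I := by
  simpa using hI a ha s 1

theorem IsIdealSet.mul_right {I : Set M} (hI : IsIdealSet I) {a : M} (ha : a ∈ I) (t : M) :
    a * t ∈ I := by
  simpa using hI a ha 1 t

/-- An idempotent `e` generating a `J`-class that is minimal outside the ideal `I`. -/
structure IsMinimalOutside (I : Set M) (e : M) : Prop where
  idem : e * e = e
  notMem : e ∉ I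
  generates : ∀ s t : M, s * e * t ∉ I → ∃ p q : M, p * (s * e * t) * q = e

/-- The ideal generated by `I` and `e`. -/
def adjoinIdeal (I : Set M) (e : M) : Set M := I ∪ principalIdeal e

theorem subset_adjoinIdeal (I : Set M) (e : M) : I ⊆ adjoinIdeal I e :=
  Set.subset_union_left

theorem IsIdealSet.adjoin {I : Set M} (hI : IsIdealSet I) (e : M) :
    IsIdealSet (adjoinIdeal I e) := by
  rintro a (ha | ⟨p, q, rfl⟩) s t
  · exact Or.inl (hI a ha s t)
  · exact Or.inr ⟨s * p, q * t, by simp only [mul_assoc]⟩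

/-- Among the elements outside `I` choose `a` with minimal principal ideal. If `a * t * a = a`, then
`a * t` is an idempotent generating the same ideal. -/
theorem exists_isMinimalOutside [Finite M] (hreg : IsRegularMonoid M) {I : Set M}
    (hI : IsIdealSet I) (hne : I ≠ Set.univ) : ∃ e : M, IsMinimalOutside I e := by
  obtain ⟨a₀, ha₀⟩ := (Set.ne_univ_iff_exists_notMem I).mp hne
  obtain ⟨a, ha, hmin⟩ := (Set.toFinite {a : M | a ∉ I}).exists_minimalFor
    (fun a => principalIdeal a) _ ⟨a₀, ha₀⟩
  obtain ⟨t, ht⟩ := hreg a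
  have hsub : ∀ x : M, x ∈ principalIdeal a → principalIdeal x ⊆ principalIdeal a := by
    rintro x ⟨p, q, rfl⟩ y ⟨s, t, rfl⟩
    exact ⟨s * p, q * t, by simp only [mul_assoc]⟩
  have hself : ∀ x : M, x ∈ principalIdeal x := fun x => ⟨1, 1, by simp⟩
  refine ⟨a * t, by rw [← mul_assoc, ht], fun h => ha ?_, fun p q h => ?_⟩
  · rw [← ht]; exact hI.mul_right h a
  · have hx : p * (a * t) * q ∈ principalIdeal a := ⟨p, t * q, by simp only [mul_assoc]⟩
    have := hmin h (hsub _ hx) (show a * t ∈ principalIdeal a from ⟨1, t, by simp⟩)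
    obtain ⟨r, s, hrs⟩ := this
    exact ⟨r, s, hrs.symm⟩

/-- Compressing `s` and `t` to `eMe` turns the relation into an equation there. In a finite monoid
one-sided inverses are two-sided, so `x` is a unit of `eMe`, and that unit group is trivial. -/
theorem eq_of_mem_local [Finite M] (hap : IsAperiodicMonoid M) {e x s t : M} (he : e * e = e)
    (hex : e * x = x) (hxe : x * e = x) (h : s * x * t = e) : x = e := by
  have he' : IsIdempotentElem e := he
  have hmem : ∀ y : M, e * y * e ∈ Subsemigroup.corner e := fun y =>
    (Subsemigroup.mem_corner_iff he').mpr ⟨by rw [← mul_assoc, ← mul_assoc, he],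
      by rw [mul_assoc, he]⟩
  let X : LocalMonoid he' := ⟨x, (Subsemigroup.mem_corner_iff he').mpr ⟨hex, hxe⟩⟩
  let S : LocalMonoid he' := ⟨e * s * e, hmem s⟩
  let T : LocalMonoid he' := ⟨e * t * e, hmem t⟩
  have hfin : Finite (LocalMonoid he') :=
    inferInstanceAs (Finite (Subsemigroup.corner e))
  have h1 : S * (X * T) = 1 := by
    refine Subtype.ext ?_
    change e * s * e * (x * (e * t * e)) = e
    calc e * s * e * (x * (e * t * e)) = e * s * (e * x) * e * t * e := by simp only [mul_assoc]
      _ = e * (s * (x * e) * t) * e := by rw [hex]; simp only [mul_assoc]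
      _ = e := by rw [hxe, h, he, he]
  have h2 : X * T * S = 1 := mul_eq_one_symm (M := LocalMonoid he') h1
  rw [mul_assoc] at h2
  have h3 : T * S * X = 1 := mul_eq_one_symm (M := LocalMonoid he') h2
  have := hap e he'
  have h4 : (Units.mk X (T * S) h2 h3 : MaximalSubgroup he') = 1 := Subsingleton.elim _ _
  have h5 : X = 1 := congrArg Units.val h4
  exact congrArg Subtype.val h5

variable [Finite M]

theorem IsMinimalOutside.eq_of_local (hap : IsAperiodicMonoid M) {I : Set M} {e : M}
    (he : IsMinimalOutside I e) {x : M} (hex : e * x = x) (hxe : x * e = x)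
    (hx : x ∉ I) : x = e := by
  have h : 1 * e * x = x := by rw [one_mul, hex]
  obtain ⟨p, q, hpq⟩ := he.generates 1 x (by rwa [h])
  rw [h] at hpq
  exact eq_of_mem_local hap he.idem hex hxe hpq

/-- Minimality gives `p * x * q = e`. Then `e * p * x` lies in `eMe`, and outside `I` because
multiplying it by `q` gives `e`; so it is `e` itself. -/
theorem IsMinimalOutside.exists_mul_left (hap : IsAperiodicMonoid M) {I : Set M}
    (hI : IsIdealSet I) {e : M} (he : IsMinimalOutside I e)
    {x : M} (hxe : x * e = x) (hx : x ∉ I) :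
    ∃ s, s * x = e := by
  have h : x * e * 1 = x := by rw [mul_one, hxe]
  obtain ⟨p, q, hpq⟩ := he.generates x 1 (by rwa [h])
  rw [h] at hpq
  refine ⟨e * p, ?_⟩
  apply he.eq_of_local hap
  · rw [← mul_assoc, ← mul_assoc, he.idem]
  · rw [mul_assoc, hxe]
  · intro hmem
    apply he.notMem
    have := hI.mul_right hmem q
    rwa [mul_assoc, mul_assoc, ← mul_assoc p, hpq, he.idem] at this

theorem IsMinimalOutside.exists_mul_right (hap : IsAperiodicMonoid M) {I : Set M}
    (hI : IsIdealSet I) {e : M} (he : IsMinimalOutside I e)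
    {y : M} (hey : e * y = y) (hy : y ∉ I) :
    ∃ t, y * t = e := by
  have h : 1 * e * y = y := by rw [one_mul, hey]
  obtain ⟨p, q, hpq⟩ := he.generates 1 y (by rwa [h])
  rw [h] at hpq
  refine ⟨q * e, ?_⟩
  apply he.eq_of_local hap
  · rw [← mul_assoc, hey]
  · rw [mul_assoc, mul_assoc, he.idem]
  · intro hmem
    apply he.notMem
    have := hI.mul_left hmem p
    rwa [← mul_assoc, ← mul_assoc, hpq, he.idem] at this

theorem IsMinimalOutside.mul_notMem (hap : IsAperiodicMonoid M) {I : Set M}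
    (hI : IsIdealSet I) {e : M} (he : IsMinimalOutside I e)
    {x y : M} (hxe : x * e = x) (hx : x ∉ I) (hey : e * y = y)
    (hy : y ∉ I) : x * y ∉ I := by
  obtain ⟨s, hs⟩ := he.exists_mul_left hap hI hxe hx
  obtain ⟨t, ht⟩ := he.exists_mul_right hap hI hey hy
  intro h
  have := hI _ h s t
  rw [← mul_assoc, hs, mul_assoc, ht, he.idem] at this
  exact he.notMem this

theorem IsMinimalOutside.mul_injective (hap : IsAperiodicMonoid M) {I : Set M}
    (hI : IsIdealSet I) {e : M} (he : IsMinimalOutside I e)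
    {x y x' y' : M} (hxe : x * e = x) (hx : x ∉ I)
    (hey : e * y = y) (hy : y ∉ I) (hxe' : x' * e = x') (hey' : e * y' = y')
    (h : x * y = x' * y') : x = x' ∧ y = y' := by
  obtain ⟨s, hs⟩ := he.exists_mul_left hap hI hxe hx
  obtain ⟨t, ht⟩ := he.exists_mul_right hap hI hey hy
  -- Cancelling `y` on the right expresses `x` as `x'` times an element of `eMe`. That element is
  -- outside `I` since `x` is, so it equals `e`; `y` is treated symmetrically.
  have hx1 : x = x' * (e * (y' * t) * e) := by
    calc x = x * (y * t) := by rw [ht, hxe]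
      _ = x * y * t * e := by rw [mul_assoc, mul_assoc, ← mul_assoc y, ht, he.idem]
      _ = x' * y' * t * e := by rw [h]
      _ = x' * e * (y' * t) * e := by rw [hxe']; simp only [mul_assoc]
      _ = _ := by simp only [mul_assoc]
  have hy1 : y = e * (s * x') * e * y' := by
    calc y = s * x * y := by rw [hs, hey]
      _ = e * (s * (x * y)) := by rw [← mul_assoc s, hs, hey, hey]
      _ = e * (s * (x' * y')) := by rw [h]
      _ = e * (s * x') * (e * y') := by rw [hey']; simp only [mul_assoc]
      _ = _ := by simp only [mul_assoc]
  have e1 : e * (y' * t) * e = e := by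
    refine he.eq_of_local hap ?_ ?_ fun hmem => hx ?_
    · rw [← mul_assoc, ← mul_assoc, he.idem]
    · rw [mul_assoc, he.idem]
    · rw [hx1]; exact hI.mul_left hmem _
  have e2 : e * (s * x') * e = e := by
    refine he.eq_of_local hap ?_ ?_ fun hmem => hy ?_
    · rw [← mul_assoc, ← mul_assoc, he.idem]
    · rw [mul_assoc, he.idem]
    · rw [hy1]; exact hI.mul_right hmem _
  exact ⟨by rw [hx1, e1, hxe'], by rw [hy1, e2, hey']⟩

end Ideals

/-! ### Counting J-classes in an ideal -/

section Counting

variable {M : Type u} [Monoid M]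

/-- The number of `J`-classes meeting a subset of the monoid. -/
noncomputable def jCount (I : Set M) : ℕ :=
  ((Quotient.mk (greenJ M)) '' I).ncard

theorem jCount_empty : jCount (∅ : Set M) = 0 := by
  simp [jCount]

theorem jCount_le [Finite M] (I : Set M) : jCount I ≤ numJClasses M := by
  rw [numJClasses, ← Set.ncard_univ]
  exact Set.ncard_le_ncard (Set.subset_univ _) (Set.toFinite _)

theorem mem_of_greenJ {I : Set M} (hI : IsIdealSet I) {a b : M}
    (h : (Quotient.mk (greenJ M) a) = Quotient.mk (greenJ M) b) (ha : a ∈ I) : b ∈ I := by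
  have hab : principalIdeal a = principalIdeal b := Quotient.exact h
  have hb : b ∈ principalIdeal a := by rw [hab]; exact ⟨1, 1, by simp⟩
  obtain ⟨s, t, rfl⟩ := hb
  exact hI a ha s t

/-- By minimality every element of `MeM` outside `I` is J-equivalent to `e`, and ideals are unions
of J-classes. -/
theorem jCount_adjoinIdeal [Finite M] {I : Set M} (hI : IsIdealSet I) {e : M}
    (he : IsMinimalOutside I e) : jCount (adjoinIdeal I e) = jCount I + 1 := by
  have h : (Quotient.mk (greenJ M)) '' (adjoinIdeal I e) =
      insert (Quotient.mk (greenJ M) e) ((Quotient.mk (greenJ M)) '' I) := by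
    ext c
    constructor
    · rintro ⟨x, hx, rfl⟩
      by_cases hxI : x ∈ I
      · exact Or.inr ⟨x, hxI, rfl⟩
      · obtain ⟨s, t, rfl⟩ := hx.resolve_left hxI
        obtain ⟨p, q, hpq⟩ := he.generates s t hxI
        left
        refine Quotient.sound (show principalIdeal _ = principalIdeal _ from ?_)
        apply Set.Subset.antisymm
        · rintro _ ⟨a, b, rfl⟩
          exact ⟨a * s, t * b, by simp only [mul_assoc]⟩
        · rintro _ ⟨a, b, rfl⟩
          refine ⟨a * p, q * b, ?_⟩
          conv_lhs => rw [← hpq]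
          simp only [mul_assoc]
    · rintro (rfl | ⟨x, hx, rfl⟩)
      · exact ⟨e, Or.inr ⟨1, 1, by simp⟩, rfl⟩
      · exact ⟨x, Or.inl hx, rfl⟩
  rw [jCount, jCount, h, Set.ncard_insert_of_notMem _ (Set.toFinite _)]
  rintro ⟨x, hx, hxe⟩
  exact he.notMem (mem_of_greenJ hI hxe hx)

end Counting

/-! ### Subgroups of projective abelian groups -/

section IntProjective

/-- A subgroup of a projective abelian group is projective. -/
theorem projective_int_submodule {F : Type w} [AddCommGroup F] [Module.Projective ℤ F]
    (K : Submodule ℤ F) : Module.Projective ℤ K := by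
  refine Module.Projective.of_lifting_property'' fun p hp => ?_
  let ι : (K →₀ ℤ) →ₗ[ℤ] (K →₀ ℚ) := Finsupp.mapRange.linearMap (Algebra.linearMap ℤ ℚ)
  have hι : Function.Injective ι :=
    Finsupp.mapRange_injective _ (map_zero _) (algebraMap ℤ ℚ).injective_int
  -- `K` is the free group modulo `ker p`, so it embeds in the divisible, hence injective, group `(K
  -- →₀ ℚ) ⧸ N`. The embedding `j` extends to `F`, and the extension lifts to `K →₀ ℚ` since `F` is
  -- projective.
  let N : Submodule ℤ (K →₀ ℚ) := (LinearMap.ker p).map ι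
  have hdiv : ∀ {n : ℤ}, n ≠ 0 → Function.Surjective fun a : (K →₀ ℚ) ⧸ N => n • a := by
    intro n hn a
    obtain ⟨x, rfl⟩ := Submodule.Quotient.mk_surjective N a
    refine ⟨Submodule.Quotient.mk ((n : ℚ)⁻¹ • x), ?_⟩
    change Submodule.Quotient.mk (n • ((n : ℚ)⁻¹ • x)) = _
    rw [← Int.cast_smul_eq_zsmul ℚ n, smul_smul, mul_inv_cancel₀ (by exact_mod_cast hn), one_smul]
  let _ : DivisibleBy ((K →₀ ℚ) ⧸ N) ℤ := divisibleByOfSMulRightSurj _ _ hdiv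
  have hle : LinearMap.ker p ≤ LinearMap.ker (N.mkQ ∘ₗ ι) := fun x hx => by
    rw [LinearMap.mem_ker, LinearMap.comp_apply, Submodule.mkQ_apply, Submodule.Quotient.mk_eq_zero]
    exact Submodule.mem_map_of_mem hx
  let j : K →ₗ[ℤ] (K →₀ ℚ) ⧸ N :=
    (LinearMap.ker p).liftQ (N.mkQ ∘ₗ ι) hle ∘ₗ (p.quotKerEquivOfSurjective hp).symm.toLinearMap
  have hj : ∀ x, j (p x) = N.mkQ (ι x) := fun x => by
    have : (p.quotKerEquivOfSurjective hp).symm (p x) = Submodule.Quotient.mk x := by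
      rw [LinearEquiv.symm_apply_eq]; rfl
    simp [j, this]
  obtain ⟨h, hh⟩ := (Module.Baer.of_divisible ((K →₀ ℚ) ⧸ N)).extension_property
    K.subtype K.injective_subtype j
  obtain ⟨h', hh'⟩ := Module.projective_lifting_property N.mkQ h N.mkQ_surjective
  -- On `K` the lift differs from an integral vector by an element of `N`, itself integral. So the
  -- lift restricts to a section of `p`.
  have key : ∀ k : K, ∃ z, ι z = h' k ∧ p z = k := fun k => by
    obtain ⟨x, rfl⟩ := hp k
    have h1 : N.mkQ (h' (p x)) = N.mkQ (ι x) := by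
      rw [← hj, ← hh, ← hh']; rfl
    obtain ⟨y, hy, hxy⟩ := (Submodule.Quotient.eq N).mp h1
    exact ⟨y + x, by rw [map_add, hxy, sub_add_cancel], by
      rw [map_add, LinearMap.mem_ker.mp hy, zero_add]⟩
  let s : K →ₗ[ℤ] (K →₀ ℤ) := (LinearEquiv.ofInjective ι hι).symm.toLinearMap ∘ₗ
    (h' ∘ₗ K.subtype).codRestrict (LinearMap.range ι) fun k => (key k).imp fun z hz => hz.1
  refine ⟨s, LinearMap.ext fun k => ?_⟩
  obtain ⟨z, hz, hpz⟩ := key k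
  have : s k = z := by
    simp only [s, LinearMap.comp_apply, LinearEquiv.coe_coe]
    rw [LinearEquiv.symm_apply_eq]
    exact Subtype.ext hz.symm
  rw [LinearMap.comp_apply, this, hpz, LinearMap.id_apply]

end IntProjective

/-! ### Short exact sequences of modules -/

section ProjectiveDimension

variable {R : Type u} [Ring R] {V₁ V₂ V₃ : Type w} [AddCommGroup V₁] [AddCommGroup V₂]
  [AddCommGroup V₃] [Module R V₁] [Module R V₂] [Module R V₃]

theorem shortExact_of_linearMap (f : V₁ →ₗ[R] V₂) (g : V₂ →ₗ[R] V₃)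
    (hf : Function.Injective f) (hg : Function.Surjective g) (hfg : Function.Exact f g) :
    (ModuleCat.shortComplexOfCompEqZero f g hfg.linearMap_comp_eq_zero).ShortExact :=
  ModuleCat.shortComplex_shortExact _ hfg hf hg

end ProjectiveDimension

/-! ### Splicing resolutions; vanishing of derived functors -/

section FiniteResolution

open Limits

variable {C : Type u} [Category.{v} C] [Abelian C]

/-- The augmentation `P₀ ⟶ X` of a projective resolution of `X`. -/
noncomputable def resolutionAug {X : C} (P : ProjectiveResolution X) : P.complex.X 0 ⟶ X :=
  P.π.f 0

instance {X : C} (P : ProjectiveResolution X) : Epi (resolutionAug P) :=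
  inferInstanceAs (Epi (P.π.f 0))

theorem d_comp_resolutionAug {X : C} (P : ProjectiveResolution X) :
    P.complex.d 1 0 ≫ resolutionAug P = 0 :=
  P.complex_d_comp_π_f_zero

theorem d_comp_resolutionAug_comp {X Y : C} (P : ProjectiveResolution X) (f : X ⟶ Y) :
    P.complex.d 1 0 ≫ resolutionAug P ≫ f = 0 := by
  rw [← Category.assoc, d_comp_resolutionAug, zero_comp]

theorem exact_d_resolutionAug {X : C} (P : ProjectiveResolution X) :
    (ShortComplex.mk _ _ (d_comp_resolutionAug P)).Exact :=
  ShortComplex.exact_of_g_is_cokernel _ P.isColimitCokernelCofork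

/-- A monomorphism after the augmentation does not change its kernel. -/
theorem exact_d_resolutionAug_comp {X Y : C} (P : ProjectiveResolution X) (f : X ⟶ Y) [Mono f] :
    (ShortComplex.mk _ _ (d_comp_resolutionAug_comp P f)).Exact := by
  let α : ShortComplex.mk _ _ (d_comp_resolutionAug P) ⟶
      ShortComplex.mk _ _ (d_comp_resolutionAug_comp P f) :=
    { τ₁ := 𝟙 _
      τ₂ := 𝟙 _
      τ₃ := f }
  have : Mono α.τ₃ := ‹Mono f›
  have : IsIso α.τ₂ := inferInstanceAs (IsIso (𝟙 _))
  have : Epi α.τ₁ := inferInstanceAs (Epi (𝟙 _))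
  exact (ShortComplex.exact_iff_of_epi_of_isIso_of_mono α).mp (exact_d_resolutionAug P)

theorem resolutionAug_comp_f_comp_g {S : ShortComplex C} (P : ProjectiveResolution S.X₁) :
    (resolutionAug P ≫ S.f) ≫ S.g = 0 := by
  simp

/-- An epimorphism before `S.f` does not change its image. -/
theorem exact_resolutionAug_comp {S : ShortComplex C} (hS : S.Exact)
    (P : ProjectiveResolution S.X₁) :
    (ShortComplex.mk _ _ (resolutionAug_comp_f_comp_g P)).Exact := by
  let α : ShortComplex.mk _ _ (resolutionAug_comp_f_comp_g P) ⟶ S :=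
    { τ₁ := resolutionAug P
      τ₂ := 𝟙 _
      τ₃ := 𝟙 _ }
  have : Epi α.τ₁ := inferInstanceAs (Epi (resolutionAug P))
  have : IsIso α.τ₂ := inferInstanceAs (IsIso (𝟙 _))
  have : Mono α.τ₃ := inferInstanceAs (Mono (𝟙 _))
  exact (ShortComplex.exact_iff_of_epi_of_isIso_of_mono α).mpr hS

/-- The complex obtained by splicing a projective resolution of the kernel of an epimorphism
`F ⟶ X` with `F`. -/
noncomputable def spliceComplex {S : ShortComplex C} (P : ProjectiveResolution S.X₁) :
    ChainComplex C ℕ :=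
  P.complex.augment (resolutionAug P ≫ S.f) (d_comp_resolutionAug_comp P S.f)

theorem spliceComplex_exactAt_succ {S : ShortComplex C} (hS : S.ShortExact)
    (P : ProjectiveResolution S.X₁) (n : ℕ) : (spliceComplex P).ExactAt (n + 1) := by
  rw [HomologicalComplex.exactAt_iff' _ (n + 1 + 1) (n + 1) n (by simp) (by simp)]
  have := hS.mono_f
  match n with
  | 0 => exact exact_d_resolutionAug_comp P S.f
  | n + 1 => exact P.exact_succ n

/-- An exact augmented complex of projective objects is a projective resolution. -/
noncomputable def resolutionOfExact {X : C} (K : ChainComplex C ℕ) (hK : ∀ n, Projective (K.X n))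
    (π : K.X 0 ⟶ X) (hπ : Epi π) (w : K.d 1 0 ≫ π = 0) (h₀ : (ShortComplex.mk _ _ w).Exact)
    (h : ∀ n, K.ExactAt (n + 1)) : ProjectiveResolution X where
  complex := K
  projective := hK
  π := (ChainComplex.toSingle₀Equiv _ _).symm ⟨π, w⟩
  quasiIso := ⟨fun n => by
    cases n
    · rw [ChainComplex.quasiIsoAt₀_iff, ShortComplex.quasiIso_iff_of_zeros']
      · refine (ShortComplex.exact_and_epi_g_iff_of_iso (S₂ := ShortComplex.mk _ _ w) ?_).2
          ⟨h₀, hπ⟩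
        exact ShortComplex.isoMk (Iso.refl _) (Iso.refl _) (Iso.refl _)
          ((Category.id_comp _).trans (Category.comp_id _).symm)
          ((Category.id_comp _).trans
            ((ChainComplex.toSingle₀Equiv_symm_apply_f_zero π w).symm.trans
              (Category.comp_id _).symm))
      · exact K.shape 0 0 (by simp)
      all_goals rfl
    · rw [quasiIsoAt_iff_exactAt']
      · exact h _
      · apply ChainComplex.exactAt_succ_single_obj⟩

/-- A projective resolution of the kernel of an epimorphism `F ⟶ X` with `F` projective gives a
projective resolution of `X`. -/
noncomputable def spliceResolution {S : ShortComplex C} (hS : S.ShortExact) (hP : Projective S.X₂)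
    (P : ProjectiveResolution S.X₁) : ProjectiveResolution S.X₃ :=
  resolutionOfExact (spliceComplex P)
    (fun n => match n with
      | 0 => hP
      | n + 1 => P.projective n)
    S.g hS.epi_g (resolutionAug_comp_f_comp_g P) (exact_resolutionAug_comp hS.exact P)
    (spliceComplex_exactAt_succ hS P)

/-- A finitely generated module of finite projective dimension over a left Noetherian ring has a
finite resolution by finitely generated projective modules. -/
theorem exists_finite_projectiveResolution {R : Type u} [Ring R] [IsNoetherianRing R] (d : ℕ)
    (X : ModuleCat.{u} R) [Module.Finite R X] [HasProjectiveDimensionLE X d] :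
    ∃ P : ProjectiveResolution X, (∀ i : ℕ, Module.Finite R (P.complex.X i)) ∧
      ∀ i : ℕ, d < i → IsZero (P.complex.X i) := by
  induction d generalizing X with
  | zero =>
    have : Projective X := (projective_iff_hasProjectiveDimensionLE_zero X).mpr inferInstance
    have hz : ∀ i, 0 < i → IsZero ((ProjectiveResolution.self X).complex.X i) := fun i hi =>
      HomologicalComplex.isZero_single_obj_X _ _ _ _ hi.ne'
    refine ⟨ProjectiveResolution.self X, fun i => ?_, hz⟩
    cases i with
    | zero => exact inferInstanceAs (Module.Finite R X)
    | succ i =>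
      have := ModuleCat.subsingleton_of_isZero (hz (i + 1) i.succ_pos)
      infer_instance
  | succ d ih =>
    obtain ⟨n, f, hf⟩ := Module.Finite.exists_fin' R X
    let g : ULift.{u} (Fin n → R) →ₗ[R] X := f ∘ₗ ULift.moduleEquiv.toLinearMap
    have hg : Function.Surjective g := hf.comp ULift.moduleEquiv.surjective
    have hS := LinearMap.shortExact_shortComplexKer hg
    have hP : Projective g.shortComplexKer.X₂ :=
      (IsProjective.iff_projective (R := R) _).mp inferInstance
    -- The syzygy drops the dimension by one; it is finitely generated because `R` is Noetherian.
    have : HasProjectiveDimensionLE (ModuleCat.of R (LinearMap.ker g)) d :=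
      (hS.hasProjectiveDimensionLT_X₃_iff d hP).mp ‹_›
    obtain ⟨P, hfin, hzero⟩ := ih (ModuleCat.of R (LinearMap.ker g))
    refine ⟨spliceResolution hS hP P, fun i => ?_, fun i hi => ?_⟩
    · cases i with
      | zero => exact inferInstanceAs (Module.Finite R (ULift (Fin n → R)))
      | succ i => exact hfin i
    · obtain ⟨i, rfl⟩ := Nat.exists_eq_succ_of_ne_zero (by omega : i ≠ 0)
      exact hzero i (by omega)

theorem isZero_leftDerived_of_isZero {D : Type*} [Category* D] [Abelian D]
    [HasProjectiveResolutions C] (F : C ⥤ D) [F.Additive] {X : C} (P : ProjectiveResolution X)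
    {n : ℕ} (h : IsZero (P.complex.X n)) : IsZero ((F.leftDerived n).obj X) := by
  refine IsZero.of_iso ?_ (P.isoLeftDerivedObj F n)
  refine HomologicalComplex.ExactAt.isZero_homology ?_
  exact ShortComplex.exact_of_isZero_X₂ _ (F.map_isZero h)

end FiniteResolution

/-! ### Modules of functions on partial action sets -/

section PartialAction

variable {M : Type u} [Monoid M]

/-- An additive map between `ℤM`-modules that commutes with `M` is `ℤM`-linear. -/
def linearMapOfEquivariant {V : Type v} {V' : Type w} [AddCommGroup V] [AddCommGroup V']
    [Module (MonoidAlgebra ℤ M) V] [Module (MonoidAlgebra ℤ M) V'] (f : V →ₗ[ℤ] V')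
    (h : ∀ (m : M) (v : V), f (MonoidAlgebra.of ℤ M m • v) = MonoidAlgebra.of ℤ M m • f v) :
    V →ₗ[MonoidAlgebra ℤ M] V' where
  toFun := f
  map_add' := map_add f
  map_smul' c v := by
    induction c using MonoidAlgebra.induction_linear with
    | zero => simp
    | add a b ha hb => simp only [add_smul, map_add, ha, hb]
    | single m r =>
      have hr : MonoidAlgebra.single m r = (r : MonoidAlgebra ℤ M) * MonoidAlgebra.of ℤ M m := by
        rw [← zsmul_eq_mul, MonoidAlgebra.of_apply]
        simp
      simp only [RingHom.id_apply]
      rw [hr, mul_smul, mul_smul, Int.cast_smul_eq_zsmul, Int.cast_smul_eq_zsmul, map_zsmul, h]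

/-- A set on which `M` acts partially by left multiplication: products leaving the set never
come back. -/
structure PartialActionSet (M : Type u) [Monoid M] where
  /-- The underlying set. -/
  carrier : Set M
  mem_of_mul_mem : ∀ x ∈ carrier, ∀ s t : M, s * (t * x) ∈ carrier → t * x ∈ carrier

open scoped Classical in
/-- The effect of `m` on the functions on a partial action set: a product that leaves the set is
replaced by `0`. -/
noncomputable def partialAct (X : PartialActionSet M) (W : Type w) [AddCommGroup W] (m : M) :
    (X.carrier →₀ W) →ₗ[ℤ] (X.carrier →₀ W) :=
  Finsupp.lsum ℤ fun x => if h : m * x.1 ∈ X.carrier then Finsupp.lsingle ⟨m * x.1, h⟩ else 0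

theorem partialAct_single_of_mem (X : PartialActionSet M) {W : Type w} [AddCommGroup W] {m : M}
    {x : X.carrier} (h : m * x.1 ∈ X.carrier) (w : W) :
    partialAct X W m (Finsupp.single x w) = Finsupp.single ⟨m * x.1, h⟩ w := by
  simp [partialAct, h]

theorem partialAct_single_of_notMem (X : PartialActionSet M) {W : Type w} [AddCommGroup W] {m : M}
    {x : X.carrier} (h : m * x.1 ∉ X.carrier) (w : W) :
    partialAct X W m (Finsupp.single x w) = 0 := by
  simp [partialAct, h]

/-- The action of `M` on the functions on a partial action set. -/
noncomputable def partialActHom (X : PartialActionSet M) (W : Type w) [AddCommGroup W] :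
    M →* Module.End ℤ (X.carrier →₀ W) where
  toFun := partialAct X W
  map_one' := by
    refine Finsupp.lhom_ext fun x w => ?_
    have h : (1 : M) * x.1 ∈ X.carrier := by rw [one_mul]; exact x.2
    rw [partialAct_single_of_mem X h]
    congr 1
    exact Subtype.ext (one_mul _)
  map_mul' s t := by
    refine Finsupp.lhom_ext fun x w => ?_
    rw [Module.End.mul_apply]
    by_cases ht : t * x.1 ∈ X.carrier
    · rw [partialAct_single_of_mem X ht]
      by_cases hs : s * (t * x.1) ∈ X.carrier
      · rw [partialAct_single_of_mem X (m := s) (x := ⟨t * x.1, ht⟩) hs,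
          partialAct_single_of_mem X (m := s * t) (x := x) (by rwa [mul_assoc])]
        congr 1
        exact Subtype.ext (mul_assoc _ _ _)
      · rw [partialAct_single_of_notMem X (m := s) (x := ⟨t * x.1, ht⟩) hs,
          partialAct_single_of_notMem X (m := s * t) (x := x) (by rwa [mul_assoc])]
    -- Associativity could fail only here: once `t * x` has left the set, `s * t * x` must stay
    -- outside, which is the axiom of a partial action set.
    · rw [partialAct_single_of_notMem X ht, map_zero]
      refine partialAct_single_of_notMem X (fun h => ht ?_) w
      exact X.mem_of_mul_mem x.1 x.2 s t (by rwa [← mul_assoc])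

/-- The `ℤM`-module `ℤX ⊗ W` of finitely supported `W`-valued functions on a partial action
set `X`. -/
def FunModule (X : PartialActionSet M) (W : Type w) [AddCommGroup W] : Type (max u w) :=
  X.carrier →₀ W

namespace FunModule

variable {X : PartialActionSet M} {W : Type w} [AddCommGroup W]

noncomputable instance : AddCommGroup (FunModule X W) :=
  inferInstanceAs (AddCommGroup (X.carrier →₀ W))

noncomputable instance : Module (MonoidAlgebra ℤ M) (FunModule X W) :=
  Module.compHom (X.carrier →₀ W)
    (MonoidAlgebra.lift ℤ (Module.End ℤ (X.carrier →₀ W)) M (partialActHom X W)).toRingHom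

/-- The function with value `w` at `x` and `0` elsewhere. -/
noncomputable def single (x : M) (hx : x ∈ X.carrier) : W →ₗ[ℤ] FunModule X W :=
  Finsupp.lsingle (⟨x, hx⟩ : X.carrier)

theorem of_smul_eq (m : M) (v : FunModule X W) :
    MonoidAlgebra.of ℤ M m • v = partialAct X W m v := by
  change (MonoidAlgebra.lift ℤ (Module.End ℤ (X.carrier →₀ W)) M (partialActHom X W)
    (MonoidAlgebra.of ℤ M m)) v = _
  rw [MonoidAlgebra.lift_of]
  rfl

theorem of_smul_single {m x : M} (hx : x ∈ X.carrier) (h : m * x ∈ X.carrier) (w : W) :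
    MonoidAlgebra.of ℤ M m • (single x hx w : FunModule X W) = single (m * x) h w := by
  rw [of_smul_eq]
  exact partialAct_single_of_mem X (x := ⟨x, hx⟩) h w

theorem of_smul_single_eq_zero {m x : M} (hx : x ∈ X.carrier) (h : m * x ∉ X.carrier) (w : W) :
    MonoidAlgebra.of ℤ M m • (single x hx w : FunModule X W) = 0 := by
  rw [of_smul_eq]
  exact partialAct_single_of_notMem X (x := ⟨x, hx⟩) h w

@[elab_as_elim]
theorem induction_single {motive : FunModule X W → Prop} (v : FunModule X W) (zero : motive 0)
    (add : ∀ a b, motive a → motive b → motive (a + b))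
    (single : ∀ x hx w, motive (single x hx w)) : motive v :=
  Finsupp.induction_linear v zero add fun x w => single x.1 x.2 w

/-- The value of a function at a point. -/
noncomputable def eval (x : M) (hx : x ∈ X.carrier) : FunModule X W →ₗ[ℤ] W :=
  Finsupp.lapply (⟨x, hx⟩ : X.carrier)

theorem eval_single_self (x : M) (hx : x ∈ X.carrier) (w : W) :
    eval x hx (single x hx w) = w :=
  Finsupp.single_eq_same

theorem eval_single_of_ne {x y : M} (hx : x ∈ X.carrier) (hy : y ∈ X.carrier) (h : y ≠ x) (w : W) :
    eval x hx (single y hy w) = 0 :=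
  Finsupp.single_eq_of_ne fun h' => h (congrArg Subtype.val h').symm

theorem ext_eval {v v' : FunModule X W} (h : ∀ x hx, eval x hx v = eval x hx v') : v = v' :=
  Finsupp.ext fun x => h x.1 x.2

theorem mem_of_single_eval_mem (p : Submodule (MonoidAlgebra ℤ M) (FunModule X W))
    (v : FunModule X W) (h : ∀ x hx, (single x hx (eval x hx v) : FunModule X W) ∈ p) : v ∈ p := by
  have hv : v = Finsupp.sum (N := FunModule X W) v fun x w => single x.1 x.2 w :=
    (Finsupp.sum_single v).symm
  rw [hv]
  exact Submodule.sum_mem p fun x _ => h x.1 x.2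

variable {V : Type v} [AddCommGroup V]

/-- The additive map out of `FunModule X W` with given values on the functions supported at
one point. -/
noncomputable def sumMap (f : X.carrier → W →ₗ[ℤ] V) : FunModule X W →ₗ[ℤ] V :=
  (Finsupp.lsum ℤ f : (X.carrier →₀ W) →ₗ[ℤ] V)

theorem sumMap_single (f : X.carrier → W →ₗ[ℤ] V) (x : M) (hx : x ∈ X.carrier) (w : W) :
    sumMap f (single x hx w) = f ⟨x, hx⟩ w :=
  Finsupp.sum_single_index (map_zero (f ⟨x, hx⟩))

variable [Module (MonoidAlgebra ℤ M) V]

/-- A linear map out of `FunModule X W`, given by its values on the functions supported at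
one point. -/
noncomputable def lift (f : X.carrier → W →ₗ[ℤ] V)
    (hmem : ∀ (m x : M) (hx : x ∈ X.carrier) (h : m * x ∈ X.carrier) (w : W),
      MonoidAlgebra.of ℤ M m • f ⟨x, hx⟩ w = f ⟨m * x, h⟩ w)
    (hzero : ∀ (m x : M) (hx : x ∈ X.carrier) (_ : m * x ∉ X.carrier) (w : W),
      MonoidAlgebra.of ℤ M m • f ⟨x, hx⟩ w = 0) :
    FunModule X W →ₗ[MonoidAlgebra ℤ M] V :=
  linearMapOfEquivariant (sumMap f) (by
    intro m v
    induction v using induction_single with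
    | zero => simp only [smul_zero, map_zero]
    | add a b ha hb => simp only [smul_add, map_add, ha, hb]
    | single x hx w =>
      rw [sumMap_single]
      by_cases h : m * x ∈ X.carrier
      · rw [of_smul_single hx h, sumMap_single, hmem m x hx h]
      · rw [of_smul_single_eq_zero hx h, hzero m x hx h, map_zero])

theorem lift_single (f : X.carrier → W →ₗ[ℤ] V) (hmem) (hzero) (x : M) (hx : x ∈ X.carrier)
    (w : W) : lift f hmem hzero (single x hx w) = f ⟨x, hx⟩ w :=
  sumMap_single f x hx w

end FunModule

end PartialAction

/-! ### Functoriality in the coefficients; the case of the empty ideal -/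

section Constructions

variable {M : Type u} [Monoid M]

/-- Multiplication by a ring element, as an additive map. -/
def smulInt {R : Type u} [Ring R] (V : Type v) [AddCommGroup V] [Module R V] (a : R) :
    V →ₗ[ℤ] V :=
  (DistribSMul.toAddMonoidHom V a).toIntLinearMap

theorem smulInt_apply {R : Type u} [Ring R] {V : Type v} [AddCommGroup V] [Module R V] (a : R)
    (x : V) : smulInt V a x = a • x :=
  rfl

namespace FunModule

variable {X : PartialActionSet M} {W : Type w} [AddCommGroup W] {W' : Type v} [AddCommGroup W']

theorem single_congr {x y : M} (hx : x ∈ X.carrier) (hy : y ∈ X.carrier) (h : x = y) (w : W) :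
    (single x hx w : FunModule X W) = single y hy w := by
  subst h
  rfl

theorem linearMap_ext {V : Type v} [AddCommGroup V] [Module (MonoidAlgebra ℤ M) V]
    {f g : FunModule X W →ₗ[MonoidAlgebra ℤ M] V}
    (h : ∀ x hx w, f (single x hx w) = g (single x hx w)) : f = g := by
  ext v
  induction v using induction_single with
  | zero => rw [map_zero, map_zero]
  | add a b ha hb => rw [map_add, map_add, ha, hb]
  | single x hx w => exact h x hx w

variable (X) in
/-- The map `ℤX ⊗ W → ℤX ⊗ W'` induced by `W → W'`. -/
noncomputable def map (φ : W →ₗ[ℤ] W') :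
    FunModule X W →ₗ[MonoidAlgebra ℤ M] FunModule X W' :=
  lift (fun x => single x.1 x.2 ∘ₗ φ) (fun _ _ hx h w => of_smul_single hx h (φ w))
    fun _ _ hx h w => of_smul_single_eq_zero hx h (φ w)

theorem map_single (φ : W →ₗ[ℤ] W') (x : M) (hx : x ∈ X.carrier) (w : W) :
    map X φ (single x hx w) = single x hx (φ w) :=
  lift_single _ _ _ x hx w

theorem eval_map (φ : W →ₗ[ℤ] W') (x : M) (hx : x ∈ X.carrier) (v : FunModule X W) :
    eval x hx (map X φ v) = φ (eval x hx v) := by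
  induction v using induction_single with
  | zero => simp only [map_zero]
  | add a b ha hb => simp only [map_add, ha, hb]
  | single y hy w =>
    rw [map_single]
    by_cases h : y = x
    · subst h
      rw [eval_single_self, eval_single_self]
    · rw [eval_single_of_ne hx hy h, eval_single_of_ne hx hy h, map_zero]

theorem map_injective {φ : W →ₗ[ℤ] W'} (hφ : Function.Injective φ) :
    Function.Injective (map X φ) := by
  intro v v' h
  refine ext_eval fun x hx => hφ ?_
  rw [← eval_map, ← eval_map, h]

theorem map_surjective {φ : W →ₗ[ℤ] W'} (hφ : Function.Surjective φ) :
    Function.Surjective (map X φ) := by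
  rw [← LinearMap.range_eq_top, eq_top_iff]
  intro v _
  refine mem_of_single_eval_mem _ v fun x hx => ?_
  obtain ⟨w, hw⟩ := hφ (eval x hx v)
  exact ⟨single x hx w, by rw [map_single, hw]⟩

theorem map_exact {W'' : Type*} [AddCommGroup W''] {φ : W →ₗ[ℤ] W'} {ψ : W' →ₗ[ℤ] W''}
    (h : Function.Exact φ ψ) : Function.Exact (map X φ) (map X ψ) := by
  intro v
  constructor
  · intro hv
    refine mem_of_single_eval_mem (LinearMap.range (map X φ)) v fun x hx => ?_
    obtain ⟨w, hw⟩ := (h (eval x hx v)).mp (by rw [← eval_map, hv, map_zero])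
    exact ⟨single x hx w, by rw [map_single, hw]⟩
  · rintro ⟨v, rfl⟩
    refine ext_eval fun x hx => ?_
    rw [eval_map, eval_map, map_zero, (h _).mpr ⟨_, rfl⟩]

end FunModule

/-- The complement of an ideal, as a partial action set: a basis of `ℤM / ℤI`. -/
def complSet (I : Set M) (hI : IsIdealSet I) : PartialActionSet M where
  carrier := Iᶜ
  mem_of_mul_mem _ _ s _ h h' := h (hI.mul_left h' s)

/-- The elements of `Me` outside an ideal, as a partial action set. -/
def leftClass (I : Set M) (hI : IsIdealSet I) (e : M) : PartialActionSet M where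
  carrier := {x | x * e = x ∧ x ∉ I}
  mem_of_mul_mem x hx s t h := ⟨by rw [mul_assoc, hx.1], fun h' => h.2 (hI.mul_left h' s)⟩

theorem mem_complSet {I : Set M} {hI : IsIdealSet I} {x : M} (h : x ∉ I) :
    x ∈ (complSet I hI).carrier :=
  h

theorem mem_leftClass {I : Set M} {hI : IsIdealSet I} {e x : M} (h : x * e = x) (h' : x ∉ I) :
    x ∈ (leftClass I hI e).carrier :=
  ⟨h, h'⟩

theorem mul_mem_leftClass {I : Set M} {hI : IsIdealSet I} {e x : M} (he : e * e = e)
    (h : x * e ∉ I) : x * e ∈ (leftClass I hI e).carrier :=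
  mem_leftClass (by rw [mul_assoc, he]) h

theorem isIdealSet_empty : IsIdealSet (∅ : Set M) := fun _ h => h.elim

/-- This module is `ℤM ⊗ K`, induced from `ℤ`: a linear map out of it is determined by its
restriction to `1 ⊗ K`, an arbitrary additive map. Lifting that restriction is enough. -/
theorem projective_funModule_univ {K : Type w} [AddCommGroup K] [Module.Projective ℤ K] :
    Module.Projective (MonoidAlgebra ℤ M)
      (FunModule (complSet (∅ : Set M) isIdealSet_empty) K) := by
  have hmem : ∀ x : M, x ∈ (complSet (∅ : Set M) isIdealSet_empty).carrier := fun x h => h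
  refine Module.Projective.of_lifting_property'' fun f hf => ?_
  obtain ⟨g, hg⟩ := Module.projective_lifting_property f.toAddMonoidHom.toIntLinearMap
    (FunModule.single (W := K) 1 (hmem 1)) hf
  refine ⟨FunModule.lift (fun x => smulInt _ (MonoidAlgebra.of ℤ M x.1) ∘ₗ g)
    (fun m x _ _ w => ?_) (fun m x _ h => (h (hmem _)).elim), ?_⟩
  · simp only [LinearMap.comp_apply, smulInt_apply]
    rw [map_mul, mul_smul]
  · refine FunModule.linearMap_ext fun x hx w => ?_
    rw [LinearMap.comp_apply, FunModule.lift_single, LinearMap.comp_apply, smulInt_apply,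
      map_smul, LinearMap.id_apply]
    have : f (g w) = FunModule.single 1 (hmem 1) w := LinearMap.congr_fun hg w
    rw [this, FunModule.of_smul_single _ (hmem _)]
    exact FunModule.single_congr _ _ (mul_one x) w

variable (M) in
/-- The modules `ℤ(M \ I) ⊗ W` all have projective dimension less than `k`. -/
def ComplDimLT (I : Set M) (hI : IsIdealSet I) (k : ℕ) : Prop :=
  ∀ (W : Type (max u v)) [AddCommGroup W], HasProjectiveDimensionLT
    (ModuleCat.of.{max u v} (MonoidAlgebra ℤ M) (FunModule (complSet I hI) W)) k

/-- Over `ℤ` the kernel of a free cover of `W` is projective; inducing up to `ℤM` keeps exactness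
and projectivity, so the dimension is at most one. -/
theorem complDimLT_empty : ComplDimLT.{u, v} M ∅ isIdealSet_empty 2 := by
  intro W _
  let p : (W →₀ ℤ) →ₗ[ℤ] W := Finsupp.linearCombination ℤ id
  have hp : Function.Surjective p := Finsupp.linearCombination_id_surjective ℤ W
  have hS := shortExact_of_linearMap
    (FunModule.map (complSet (∅ : Set M) isIdealSet_empty) (LinearMap.ker p).subtype)
    (FunModule.map _ p) (FunModule.map_injective (LinearMap.ker p).injective_subtype)
    (FunModule.map_surjective hp) (FunModule.map_exact (LinearMap.exact_subtype_ker_map p))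
  have := projective_int_submodule (LinearMap.ker p)
  have h1 := projective_funModule_univ (M := M) (K := LinearMap.ker p)
  have h2 := projective_funModule_univ (M := M) (K := W →₀ ℤ)
  have h1' := ModuleCat.projective_of_categoryTheory_projective
    (ModuleCat.of.{max u v} (MonoidAlgebra ℤ M)
      (FunModule (complSet (∅ : Set M) isIdealSet_empty) (LinearMap.ker p)))
  have h2' := ModuleCat.projective_of_categoryTheory_projective
    (ModuleCat.of.{max u v} (MonoidAlgebra ℤ M)
      (FunModule (complSet (∅ : Set M) isIdealSet_empty) (W →₀ ℤ)))
  exact hS.hasProjectiveDimensionLT_X₃ 1 (inferInstanceAs (HasProjectiveDimensionLT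
    (ModuleCat.of.{max u v} (MonoidAlgebra ℤ M)
      (FunModule (complSet (∅ : Set M) isIdealSet_empty) (LinearMap.ker p))) 1))
    (inferInstanceAs (HasProjectiveDimensionLT
    (ModuleCat.of.{max u v} (MonoidAlgebra ℤ M)
      (FunModule (complSet (∅ : Set M) isIdealSet_empty) (W →₀ ℤ))) 2))

end Constructions

/-! ### Adjoining one J-class to the ideal -/

section InductionStep

variable {M : Type u} [Monoid M]

open scoped Classical in
/-- The restriction map `ℤ(M \ I) ⊗ W → ℤ(M \ I') ⊗ W` for `I ⊆ I'`. -/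
noncomputable def restrictCompl {I I' : Set M} (hI : IsIdealSet I) (hI' : IsIdealSet I')
    (hle : I ⊆ I') (W : Type w) [AddCommGroup W] :
    FunModule (complSet I hI) W →ₗ[MonoidAlgebra ℤ M] FunModule (complSet I' hI') W :=
  FunModule.lift (fun x => if h : x.1 ∈ (complSet I' hI').carrier then FunModule.single x.1 h
      else 0)
    (fun m x hx h w => by
      by_cases h1 : m * x ∈ (complSet I' hI').carrier
      · have h2 : x ∈ (complSet I' hI').carrier := fun h' => h1 (hI'.mul_left h' m)
        rw [dif_pos h2, dif_pos h1, FunModule.of_smul_single h2 h1]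
      · rw [dif_neg h1]
        by_cases h2 : x ∈ (complSet I' hI').carrier
        · rw [dif_pos h2, FunModule.of_smul_single_eq_zero h2 h1]
          rfl
        · rw [dif_neg h2]
          exact smul_zero _)
    (fun m x hx h w => by
      have h1 : m * x ∉ (complSet I' hI').carrier := fun h' => h fun h'' => h' (hle h'')
      by_cases h2 : x ∈ (complSet I' hI').carrier
      · rw [dif_pos h2, FunModule.of_smul_single_eq_zero h2 h1]
      · rw [dif_neg h2]
        exact smul_zero _)

theorem restrictCompl_single_of_mem {I I' : Set M} (hI : IsIdealSet I) (hI' : IsIdealSet I')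
    (hle : I ⊆ I') {W : Type w} [AddCommGroup W] {x : M} (hx : x ∈ (complSet I hI).carrier)
    (h : x ∈ (complSet I' hI').carrier) (w : W) :
    restrictCompl hI hI' hle W (FunModule.single x hx w) = FunModule.single x h w := by
  rw [restrictCompl, FunModule.lift_single, dif_pos h]

theorem restrictCompl_single_of_notMem {I I' : Set M} (hI : IsIdealSet I) (hI' : IsIdealSet I')
    (hle : I ⊆ I') {W : Type w} [AddCommGroup W] {x : M} (hx : x ∈ (complSet I hI).carrier)
    (h : x ∉ (complSet I' hI').carrier) (w : W) :
    restrictCompl hI hI' hle W (FunModule.single x hx w) = 0 := by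
  rw [restrictCompl, FunModule.lift_single, dif_neg h]
  rfl

theorem restrictCompl_surjective {I I' : Set M} (hI : IsIdealSet I) (hI' : IsIdealSet I')
    (hle : I ⊆ I') (W : Type w) [AddCommGroup W] :
    Function.Surjective (restrictCompl hI hI' hle W) := by
  rw [← LinearMap.range_eq_top, eq_top_iff]
  intro v _
  refine FunModule.mem_of_single_eval_mem _ v fun x hx => ?_
  exact ⟨FunModule.single x (mem_complSet fun h => hx (hle h)) (FunModule.eval x hx v),
    restrictCompl_single_of_mem hI hI' hle _ hx _⟩

theorem eval_restrictCompl {I I' : Set M} (hI : IsIdealSet I) (hI' : IsIdealSet I')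
    (hle : I ⊆ I') {W : Type w} [AddCommGroup W] {x : M} (hx : x ∈ (complSet I hI).carrier)
    (h : x ∈ (complSet I' hI').carrier) (v : FunModule (complSet I hI) W) :
    FunModule.eval x h (restrictCompl hI hI' hle W v) = FunModule.eval x hx v := by
  induction v using FunModule.induction_single with
  | zero => simp only [map_zero]
  | add a b ha hb => simp only [map_add, ha, hb]
  | single y hy w =>
    by_cases hyx : y = x
    · subst hyx
      rw [restrictCompl_single_of_mem hI hI' hle hy h, FunModule.eval_single_self,
        FunModule.eval_single_self]
    · rw [FunModule.eval_single_of_ne hx hy hyx]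
      by_cases hy' : y ∈ (complSet I' hI').carrier
      · rw [restrictCompl_single_of_mem hI hI' hle hy hy', FunModule.eval_single_of_ne h hy' hyx]
      · rw [restrictCompl_single_of_notMem hI hI' hle hy hy', map_zero]

/-- The inclusion `ℤ(Me \ I) ⊗ W → ℤ(M \ I) ⊗ W`. -/
noncomputable def leftClassIncl {I : Set M} (hI : IsIdealSet I) (e : M) (W : Type w)
    [AddCommGroup W] :
    FunModule (leftClass I hI e) W →ₗ[MonoidAlgebra ℤ M] FunModule (complSet I hI) W :=
  FunModule.lift (fun x => FunModule.single x.1 (mem_complSet x.2.2))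
    (fun _ _ hx h w => FunModule.of_smul_single (X := complSet I hI) hx.2 h.2 w)
    (fun m x hx h w => FunModule.of_smul_single_eq_zero (X := complSet I hI) hx.2
      (fun h' => h ⟨by rw [mul_assoc, hx.1], h'⟩) w)

open scoped Classical in
/-- Right multiplication by `e`, as a map `ℤ(M \ I) ⊗ W → ℤ(Me \ I) ⊗ W`. -/
noncomputable def leftClassProj {I : Set M} (hI : IsIdealSet I) {e : M} (he : e * e = e)
    (W : Type w) [AddCommGroup W] :
    FunModule (complSet I hI) W →ₗ[MonoidAlgebra ℤ M] FunModule (leftClass I hI e) W :=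
  FunModule.lift (fun x => if h : x.1 * e ∉ I then
      FunModule.single (x.1 * e) (mul_mem_leftClass he h) else 0)
    (fun m x hx h w => by
      by_cases h1 : m * x * e ∈ I
      · rw [dif_neg (not_not.mpr h1)]
        by_cases h2 : x * e ∈ I
        · rw [dif_neg (not_not.mpr h2)]
          exact smul_zero _
        · rw [dif_pos h2]
          exact FunModule.of_smul_single_eq_zero (mul_mem_leftClass he h2)
            (fun h' => h'.2 (by rwa [← mul_assoc])) w
      · have h2 : x * e ∉ I := fun h' => h1 (by rw [mul_assoc]; exact hI.mul_left h' m)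
        rw [dif_pos h1, dif_pos h2]
        exact (FunModule.of_smul_single (mul_mem_leftClass he h2)
          (mem_leftClass (by rw [mul_assoc, mul_assoc, he]) (by rwa [← mul_assoc])) w).trans
            (FunModule.single_congr _ _ (mul_assoc _ _ _).symm w))
    (fun m x hx h w => by
      have h1 : m * x ∈ I := not_not.mp h
      by_cases h2 : x * e ∈ I
      · rw [dif_neg (not_not.mpr h2)]
        exact smul_zero _
      · rw [dif_pos h2]
        exact FunModule.of_smul_single_eq_zero (mul_mem_leftClass he h2)
          (fun h' => h'.2 (by rw [← mul_assoc]; exact hI.mul_right h1 e)) w)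

theorem leftClassProj_comp_incl {I : Set M} (hI : IsIdealSet I) {e : M} (he : e * e = e)
    (W : Type w) [AddCommGroup W] :
    leftClassProj hI he W ∘ₗ leftClassIncl hI e W = LinearMap.id := by
  refine FunModule.linearMap_ext fun x hx w => ?_
  rw [LinearMap.comp_apply, leftClassIncl, FunModule.lift_single, leftClassProj,
    FunModule.lift_single, dif_pos (by rw [hx.1]; exact hx.2)]
  exact FunModule.single_congr _ _ hx.1 w

/-- Right multiplication by `e` commutes with the left action and splits the inclusion of `ℤ(Me \ I)
⊗ W`; projective dimension does not grow under retracts. -/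
theorem ComplDimLT.leftClass {I : Set M} {hI : IsIdealSet I} {k : ℕ}
    (h : ComplDimLT.{u, v} M I hI k) {e : M} (he : e * e = e) (W : Type (max u v))
    [AddCommGroup W] : HasProjectiveDimensionLT
      (ModuleCat.of.{max u v} (MonoidAlgebra ℤ M) (FunModule (leftClass I hI e) W)) k := by
  have r : Retract
      (ModuleCat.of.{max u v} (MonoidAlgebra ℤ M) (FunModule (MonoidGlobalDim.leftClass I hI e) W))
      (ModuleCat.of.{max u v} (MonoidAlgebra ℤ M) (FunModule (complSet I hI) W)) :=
    { i := ModuleCat.ofHom (leftClassIncl hI e W)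
      r := ModuleCat.ofHom (leftClassProj hI he W)
      retract := by
        rw [← ModuleCat.ofHom_comp, leftClassProj_comp_incl]
        rfl }
  have := h W
  exact r.hasProjectiveDimensionLT k

/-- The elements of `eM` outside the ideal `I`. -/
def rightClass (I : Set M) (e : M) : Set M := {y | e * y = y ∧ y ∉ I}

variable [Finite M]

theorem IsMinimalOutside.mul_mem_complSet (hap : IsAperiodicMonoid M) {I : Set M}
    (hI : IsIdealSet I) {e : M} (he : IsMinimalOutside I e) {x : M}
    (hx : x ∈ (leftClass I hI e).carrier)
    (y : rightClass I e) : x * y.1 ∈ (complSet I hI).carrier :=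
  he.mul_notMem hap hI hx.1 hx.2 y.2.1 y.2.2

variable (hap : IsAperiodicMonoid M) {I : Set M} (hI : IsIdealSet I) {e : M}
  (he : IsMinimalOutside I e)

/-- The map `ℤ(Me \ I) ⊗ ℤ(eM \ I) ⊗ W → ℤ(M \ I) ⊗ W` given by multiplication. -/
noncomputable def classMul (W : Type w) [AddCommGroup W] :
    FunModule (leftClass I hI e) (rightClass I e →₀ W) →ₗ[MonoidAlgebra ℤ M]
      FunModule (complSet I hI) W :=
  FunModule.lift (fun x => Finsupp.lsum ℤ fun y : rightClass I e =>
      FunModule.single (x.1 * y.1) (he.mul_mem_complSet hap hI x.2 y))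
    (fun m x hx h w => by
      induction w using Finsupp.induction_linear with
      | zero => simp only [map_zero, smul_zero]
      | add a b ha hb => simp only [map_add, smul_add, ha, hb]
      | single y w =>
        rw [Finsupp.lsum_single, Finsupp.lsum_single]
        exact (FunModule.of_smul_single (he.mul_mem_complSet hap hI hx y)
          (by rw [← mul_assoc]; exact he.mul_mem_complSet hap hI h y) w).trans
            (FunModule.single_congr _ _ (mul_assoc _ _ _).symm w))
    (fun m x hx h w => by
      induction w using Finsupp.induction_linear with
      | zero => simp only [map_zero, smul_zero]
      | add a b ha hb => simp only [map_add, smul_add, ha, hb, add_zero]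
      | single y w =>
        rw [Finsupp.lsum_single]
        refine FunModule.of_smul_single_eq_zero (he.mul_mem_complSet hap hI hx y) (fun h' => ?_) w
        refine h (mem_leftClass (by rw [mul_assoc, hx.1]) fun h'' => h' ?_)
        rw [← mul_assoc]
        exact hI.mul_right h'' _)

theorem classMul_single {W : Type w} [AddCommGroup W] {x : M}
    (hx : x ∈ (leftClass I hI e).carrier) (y : rightClass I e) (w : W) :
    classMul hap hI he W (FunModule.single x hx (Finsupp.single y w)) =
      FunModule.single (x * y.1) (he.mul_mem_complSet hap hI hx y) w := by
  rw [classMul, FunModule.lift_single, Finsupp.lsum_single]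

/-- Rees coordinates are unique, so the coefficient at `x * y` receives only the contribution of
`(x, y)`. Injectivity of `classMul` follows. -/
theorem eval_classMul {W : Type w} [AddCommGroup W] {x : M}
    (hx : x ∈ (leftClass I hI e).carrier) (y : rightClass I e)
    (v : FunModule (leftClass I hI e) (rightClass I e →₀ W)) :
    FunModule.eval (x * y.1) (he.mul_mem_complSet hap hI hx y)
      (classMul hap hI he W v) = FunModule.eval x hx v y := by
  induction v using FunModule.induction_single with
  | zero => simp only [map_zero, Finsupp.zero_apply]
  | add a b ha hb => simp only [map_add, ha, hb, Finsupp.add_apply]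
  | single x' hx' w =>
    induction w using Finsupp.induction_linear with
    | zero => simp only [map_zero, Finsupp.zero_apply]
    | add a b ha hb => simp only [map_add, ha, hb, Finsupp.add_apply]
    | single y' w =>
      rw [classMul_single]
      by_cases h : x' * y'.1 = x * y.1
      · obtain ⟨rfl, h2⟩ := he.mul_injective hap hI hx'.1 hx'.2 y'.2.1 y'.2.2 hx.1 y.2.1 h
        obtain rfl := Subtype.ext h2
        rw [FunModule.eval_single_self, FunModule.eval_single_self, Finsupp.single_eq_same]
      · rw [FunModule.eval_single_of_ne _ _ h]
        by_cases hxx : x' = x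
        · subst hxx
          rw [FunModule.eval_single_self, Finsupp.single_eq_of_ne]
          rintro rfl
          exact h rfl
        · rw [FunModule.eval_single_of_ne _ _ hxx, Finsupp.zero_apply]

theorem classMul_injective (W : Type w) [AddCommGroup W] :
    Function.Injective (classMul hap hI he W) := by
  intro v v' h
  refine FunModule.ext_eval fun x hx => Finsupp.ext fun y => ?_
  rw [← eval_classMul hap hI he, ← eval_classMul hap hI he, h]

theorem classMul_exact (W : Type w) [AddCommGroup W] :
    Function.Exact (classMul hap hI he W)
      (restrictCompl hI (hI.adjoin e) (subset_adjoinIdeal I e) W) := by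
  rw [LinearMap.exact_iff]
  apply le_antisymm
  · intro v hv
    refine FunModule.mem_of_single_eval_mem _ v fun x hx => ?_
    -- A point `s * e * t` of the new class factors as `(s * e) * (e * t)`, so functions supported
    -- there are in the image. At the other points the restriction keeps the value, which is
    -- therefore zero.
    by_cases h : x ∈ principalIdeal e
    · obtain ⟨s, t, hst⟩ := h
      have hxst : s * e * (e * t) = x := by
        rw [hst, mul_assoc, ← mul_assoc e, he.idem, ← mul_assoc]
      have hs : s * e ∈ (leftClass I hI e).carrier :=
        ⟨by rw [mul_assoc, he.idem], fun h' => hx (by rw [hst]; exact hI.mul_right h' t)⟩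
      have ht : e * t ∈ rightClass I e :=
        ⟨by rw [← mul_assoc, he.idem],
          fun h' => hx (by rw [hst, mul_assoc]; exact hI.mul_left h' s)⟩
      refine ⟨FunModule.single (s * e) hs (Finsupp.single ⟨e * t, ht⟩ (FunModule.eval x hx v)), ?_⟩
      rw [classMul_single]
      exact FunModule.single_congr _ _ hxst _
    · have h' : x ∈ (complSet (adjoinIdeal I e) (hI.adjoin e)).carrier :=
        fun h'' => h''.elim hx h
      rw [← eval_restrictCompl hI (hI.adjoin e) (subset_adjoinIdeal I e) hx h' v,
        LinearMap.mem_ker.mp hv, map_zero, map_zero]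
      exact zero_mem _
  · rintro _ ⟨v, rfl⟩
    rw [LinearMap.mem_ker, ← LinearMap.comp_apply]
    suffices h : restrictCompl hI (hI.adjoin e) (subset_adjoinIdeal I e) W ∘ₗ classMul hap hI he W = 0
      by rw [h, LinearMap.zero_apply]
    refine FunModule.linearMap_ext fun x hx w => ?_
    rw [LinearMap.comp_apply, LinearMap.zero_apply]
    induction w using Finsupp.induction_linear with
    | zero => simp only [map_zero]
    | add a b ha hb => simp only [map_add, ha, hb, add_zero]
    | single y w =>
      rw [classMul_single, restrictCompl_single_of_notMem hI (hI.adjoin e)]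
      exact fun h' => h' (Or.inr ⟨x, y.1, by rw [hx.1]⟩)

/-- In the exact sequence of `classMul` the sub is `ℤ(Me \ I)` with coefficients `rightClass I e →₀
W`; this change of coefficients is why `ComplDimLT` ranges over all `W`. The quotient costs one more
dimension than the sub. -/
theorem ComplDimLT.adjoin (hap : IsAperiodicMonoid M) {I : Set M} (hI : IsIdealSet I) {e : M}
    (he : IsMinimalOutside I e) {k : ℕ} (h : ComplDimLT.{u, v} M I hI (k + 1)) :
    ComplDimLT.{u, v} M (adjoinIdeal I e) (hI.adjoin e) (k + 2) := by
  intro W _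
  have hS := shortExact_of_linearMap (classMul hap hI he W)
    (restrictCompl hI (hI.adjoin e) (subset_adjoinIdeal I e) W) (classMul_injective hap hI he W)
    (restrictCompl_surjective hI (hI.adjoin e) (subset_adjoinIdeal I e) W)
    (classMul_exact hap hI he W)
  have := h W
  exact hS.hasProjectiveDimensionLT_X₃ (k + 1) (h.leftClass he.idem _)
    (hasProjectiveDimensionLT_of_ge _ (k + 1) _ (by omega))

end InductionStep

/-! ### Modules killed by an ideal and the action map -/

section Annihilated

variable {M : Type u} [Monoid M]

/-- The module `V` is annihilated by the subset `I` of the monoid. -/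
def KilledBy (I : Set M) (V : Type w) [AddCommGroup V] [Module (MonoidAlgebra ℤ M) V] : Prop :=
  ∀ a ∈ I, ∀ v : V, MonoidAlgebra.of ℤ M a • v = 0

theorem KilledBy.adjoinIdeal {I : Set M} {e : M} {V : Type w} [AddCommGroup V]
    [Module (MonoidAlgebra ℤ M) V] (h : KilledBy I V)
    (he : ∀ v : V, MonoidAlgebra.of ℤ M e • v = 0) : KilledBy (adjoinIdeal I e) V := by
  rintro a (ha | ⟨s, t, rfl⟩) v
  · exact h a ha v
  · rw [map_mul, map_mul, mul_smul, mul_smul, he, smul_zero]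

variable {I : Set M} (hI : IsIdealSet I) (e : M) (V : Type w) [AddCommGroup V]
  [Module (MonoidAlgebra ℤ M) V]

/-- The subgroup `eV` of a `ℤM`-module `V`. -/
noncomputable abbrev cornerPart : Submodule ℤ V :=
  LinearMap.range (smulInt V (MonoidAlgebra.of ℤ M e))

theorem killedBy_leftClass (W : Type w) [AddCommGroup W] :
    KilledBy I (FunModule (leftClass I hI e) W) := by
  intro a ha v
  induction v using FunModule.induction_single with
  | zero => rw [smul_zero]
  | add a b ha hb => rw [smul_add, ha, hb, add_zero]
  | single x hx w =>
    exact FunModule.of_smul_single_eq_zero hx (fun h => h.2 (hI.mul_right ha x)) w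

variable {V}

/-- The action map `ℤ(Me \ I) ⊗ eV → V`. -/
noncomputable def actionMap (hV : KilledBy I V) :
    FunModule (leftClass I hI e) (cornerPart e V) →ₗ[MonoidAlgebra ℤ M] V :=
  FunModule.lift (fun x => smulInt V (MonoidAlgebra.of ℤ M x.1) ∘ₗ (cornerPart e V).subtype)
    (fun m x _ _ w => by
      simp only [LinearMap.comp_apply, smulInt_apply]
      rw [map_mul, mul_smul])
    (fun m x hx h w => by
      simp only [LinearMap.comp_apply, smulInt_apply]
      rw [← mul_smul, ← map_mul]
      refine hV _ (by_contra fun h' => h ?_) _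
      exact mem_leftClass (by rw [mul_assoc, hx.1]) h')

theorem actionMap_single (hV : KilledBy I V) {x : M} (hx : x ∈ (leftClass I hI e).carrier)
    (w : cornerPart e V) :
    actionMap hI e hV (FunModule.single x hx w) = MonoidAlgebra.of ℤ M x • (w : V) := by
  rw [actionMap, FunModule.lift_single]
  rfl

theorem smul_mem_cornerPart (v : V) : MonoidAlgebra.of ℤ M e • v ∈ cornerPart e V :=
  ⟨v, rfl⟩

variable {e}

theorem smul_of_mem_cornerPart (he : e * e = e) {w : V} (hw : w ∈ cornerPart e V) :
    MonoidAlgebra.of ℤ M e • w = w := by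
  obtain ⟨v, rfl⟩ := hw
  rw [smulInt_apply, ← mul_smul, ← map_mul, he]

/-- The image contains `eV`, because `e ⊗ ev` is sent to `ev`. -/
theorem killedBy_quotient_actionMap (he : IsMinimalOutside I e) (hV : KilledBy I V) :
    KilledBy (adjoinIdeal I e) (V ⧸ LinearMap.range (actionMap hI e hV)) := by
  refine KilledBy.adjoinIdeal (fun a ha v => ?_) fun v => ?_
  · obtain ⟨v, rfl⟩ := Submodule.Quotient.mk_surjective _ v
    rw [← Submodule.Quotient.mk_smul, hV a ha, Submodule.Quotient.mk_zero]
  · obtain ⟨v, rfl⟩ := Submodule.Quotient.mk_surjective _ v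
    rw [← Submodule.Quotient.mk_smul, Submodule.Quotient.mk_eq_zero]
    refine ⟨FunModule.single e (mem_leftClass he.idem he.notMem)
      ⟨_, smul_mem_cornerPart e v⟩, ?_⟩
    rw [actionMap_single]
    exact smul_of_mem_cornerPart he.idem (smul_mem_cornerPart e v)

variable [Finite M]

/-- For `x` in `Me \ I` the product `e * x` lies in `eMe`, so it is either in `I` or equal to `e`.
Thus `e` acts on the source through the action map alone, and in particular kills its kernel. -/
theorem smul_eq_single_actionMap (hap : IsAperiodicMonoid M)
    (he : IsMinimalOutside I e) (hV : KilledBy I V)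
    (v : FunModule (leftClass I hI e) (cornerPart e V)) :
    MonoidAlgebra.of ℤ M e • v = FunModule.single e (mem_leftClass he.idem he.notMem)
      ((smulInt V (MonoidAlgebra.of ℤ M e)).rangeRestrict (actionMap hI e hV v)) := by
  induction v using FunModule.induction_single with
  | zero => simp only [map_zero, smul_zero]
  | add a b ha hb => simp only [map_add, smul_add, ha, hb]
  | single x hx w =>
    have hw : ((smulInt V (MonoidAlgebra.of ℤ M e)).rangeRestrict
        (actionMap hI e hV (FunModule.single x hx w)) : V) =
        MonoidAlgebra.of ℤ M (e * x) • (w : V) := by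
      rw [actionMap_single, map_mul, mul_smul]
      rfl
    by_cases h : e * x ∈ I
    · rw [hV _ h] at hw
      rw [FunModule.of_smul_single_eq_zero hx fun h' => h'.2 h, Submodule.coe_eq_zero.mp hw,
        map_zero]
    · have hex : e * x = e := he.eq_of_local hap (by rw [← mul_assoc, he.idem])
        (by rw [mul_assoc, hx.1]) h
      rw [hex, smul_of_mem_cornerPart he.idem w.2] at hw
      rw [FunModule.of_smul_single hx (mem_leftClass (by rw [mul_assoc, hx.1]) h),
        Subtype.ext hw]
      exact FunModule.single_congr _ _ hex w

theorem killedBy_ker_actionMap (hap : IsAperiodicMonoid M)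
    (he : IsMinimalOutside I e) (hV : KilledBy I V) :
    KilledBy (adjoinIdeal I e) (LinearMap.ker (actionMap hI e hV)) := by
  refine KilledBy.adjoinIdeal (fun a ha v => Subtype.ext ?_) fun v => Subtype.ext ?_
  · exact killedBy_leftClass hI e _ a ha v.1
  · refine (smul_eq_single_actionMap hI hap he hV v.1).trans ?_
    rw [LinearMap.mem_ker.mp v.2, map_zero, map_zero]
    rfl

end Annihilated

/-! ### The bound for all modules and the conclusion -/

section GlobalDimensionBound

/-- Smallness, here from countability, allows projective dimensions to be compared across universes.
-/
theorem small_monoidAlgebra (M : Type u) [Finite M] : Small.{v} (MonoidAlgebra ℤ M) :=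
  have : Countable (MonoidAlgebra ℤ M) :=
    Function.Injective.countable (f := MonoidAlgebra.coeff) MonoidAlgebra.coeff_injective
  inferInstance

variable {M : Type u} [Monoid M]

theorem hasProjectiveDimensionLT_of_killedBy_univ (V : Type w) [AddCommGroup V]
    [Module (MonoidAlgebra ℤ M) V] (hV : KilledBy (Set.univ : Set M) V) (k : ℕ) :
    HasProjectiveDimensionLT (ModuleCat.of (MonoidAlgebra ℤ M) V) k := by
  have h : ∀ v : V, v = 0 := fun v => by
    rw [← one_smul (MonoidAlgebra ℤ M) v, ← map_one (MonoidAlgebra.of ℤ M)]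
    exact hV 1 (Set.mem_univ _) v
  have hsub : Subsingleton V := ⟨fun v w => (h v).trans (h w).symm⟩
  have hz := (ModuleCat.isZero_of_subsingleton
    (ModuleCat.of (MonoidAlgebra ℤ M) V)).hasProjectiveDimensionLT_zero
  exact hasProjectiveDimensionLT_of_ge _ 0 _ (Nat.zero_le _)

variable (M) in
theorem finite_trivialModule : Module.Finite (MonoidAlgebra ℤ M) (trivialModule M) := by
  let one : trivialModule M := (ULift.up 1 : ULift.{u} ℤ)
  refine Module.Finite.of_surjective
    (LinearMap.toSpanSingleton (MonoidAlgebra ℤ M) (trivialModule M) one) fun n => ?_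
  let n' : ℤ := ULift.down.{u} (α := ℤ) n
  refine ⟨(n' : MonoidAlgebra ℤ M), ?_⟩
  rw [LinearMap.toSpanSingleton_apply, Int.cast_smul_eq_zsmul]
  refine ULift.ext _ _ ?_
  change n' • (1 : ℤ) = n'
  simp

variable [Finite M]

/-- A module annihilated by an ideal with all but `k` of the `n` classes of `M` has projective
dimension less than `n + k`. -/
theorem hasProjectiveDimensionLT_of_killedBy (hreg : IsRegularMonoid M)
    (hap : IsAperiodicMonoid M) (k : ℕ) : ∀ (I : Set M) (hI : IsIdealSet I),
      jCount I + k = numJClasses M → ComplDimLT.{u, v} M I hI (jCount I + 2) →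
      ∀ (V : Type (max u v)) [AddCommGroup V] [Module (MonoidAlgebra ℤ M) V], KilledBy I V →
        HasProjectiveDimensionLT (ModuleCat.of.{max u v} (MonoidAlgebra ℤ M) V)
          (numJClasses M + k) := by
  induction k with
  | zero =>
    intro I hI hk _ V _ _ hV
    -- All `n` classes are already in `I`; adjoining another would make the count exceed `n`.
    have hI' : I = Set.univ := by
      by_contra hne
      obtain ⟨e, he⟩ := exists_isMinimalOutside hreg hI hne
      have h1 := jCount_adjoinIdeal hI he
      have h2 := jCount_le (adjoinIdeal I e)
      omega
    subst hI'
    exact hasProjectiveDimensionLT_of_killedBy_univ V hV _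
  | succ k ih =>
    intro I hI hk hdim V _ _ hV
    by_cases hne : I = Set.univ
    · subst hne
      exact hasProjectiveDimensionLT_of_killedBy_univ V hV _
    obtain ⟨e, he⟩ := exists_isMinimalOutside hreg hI hne
    have hcount := jCount_adjoinIdeal hI he
    have ih' := ih (adjoinIdeal I e) (hI.adjoin e) (by omega)
      (by rw [hcount]; exact hdim.adjoin hap hI he)
    have hker := ih' _ (killedBy_ker_actionMap hI hap he hV)
    have hquot := ih' _ (killedBy_quotient_actionMap hI he hV)
    have hS := shortExact_of_linearMap (LinearMap.ker (actionMap hI e hV)).subtype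
      (actionMap hI e hV).rangeRestrict (Submodule.injective_subtype _)
      (LinearMap.surjective_rangeRestrict _) (by
        rw [LinearMap.exact_iff, LinearMap.ker_rangeRestrict, Submodule.range_subtype])
    have hT := shortExact_of_linearMap (LinearMap.range (actionMap hI e hV)).subtype
      (LinearMap.range (actionMap hI e hV)).mkQ (Submodule.injective_subtype _)
      (Submodule.mkQ_surjective _) (by
        rw [LinearMap.exact_iff, Submodule.ker_mkQ, Submodule.range_subtype])
    have hleft := hdim.leftClass he.idem (cornerPart e V)
    -- The kernel forces the shift by one. The bound for `ℤ(Me \ I) ⊗ eV` fits because `jCount I + 2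
    -- = n - k + 1` is at most `n + k + 1`.
    have hrange := hS.hasProjectiveDimensionLT_X₃ (numJClasses M + k) hker
      (hasProjectiveDimensionLT_of_ge _ (jCount I + 2) _ (by omega))
    exact hT.hasProjectiveDimensionLT_X₂ _ hrange
      (hasProjectiveDimensionLT_of_ge _ (numJClasses M + k) _ (by omega))

theorem numJClasses_pos : 0 < numJClasses M :=
  have : Nonempty (Quotient (greenJ M)) := ⟨Quotient.mk _ 1⟩
  Nat.card_pos

theorem hasProjectiveDimensionLT_of_regular_aperiodic (hreg : IsRegularMonoid M)
    (hap : IsAperiodicMonoid M) (V : Type (max u v)) [AddCommGroup V]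
    [Module (MonoidAlgebra ℤ M) V] :
    HasProjectiveDimensionLT (ModuleCat.of.{max u v} (MonoidAlgebra ℤ M) V)
      (2 * numJClasses M) := by
  have h := hasProjectiveDimensionLT_of_killedBy.{u, v} hreg hap (numJClasses M) ∅
    isIdealSet_empty (by rw [jCount_empty, zero_add])
    (by rw [jCount_empty]; exact complDimLT_empty) V fun _ h => h.elim
  rwa [← two_mul] at h

theorem projectiveDimension_le_of_regular_aperiodic (hreg : IsRegularMonoid M)
    (hap : IsAperiodicMonoid M) (V : ModuleCat.{v} (MonoidAlgebra ℤ M)) :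
    projectiveDimension V ≤ ((3 * numJClasses M - 2 : ℕ) : WithBot ℕ∞) := by
  have := small_monoidAlgebra.{u, v} M
  have := small_monoidAlgebra.{u, max u v} M
  have e : V ≃ₗ[MonoidAlgebra ℤ M]
      ModuleCat.of.{max u v} (MonoidAlgebra ℤ M) (ULift.{u} V) := ULift.moduleEquiv.symm
  rw [ModuleCat.projectiveDimension_eq_of_linearEquiv.{v, max u v} e, projectiveDimension_le_iff]
  have h := hasProjectiveDimensionLT_of_regular_aperiodic.{u, v} hreg hap (ULift.{u} V)
  have hpos := numJClasses_pos (M := M)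
  -- Dimension below `2n` suffices, as `2n ≤ (3n - 2) + 1` for `n ≥ 1`; positivity also makes the
  -- truncated subtraction harmless.
  exact hasProjectiveDimensionLT_of_ge _ (2 * numJClasses M) _ (by omega)

theorem isNoetherianRing_monoidAlgebra : IsNoetherianRing (MonoidAlgebra ℤ M) :=
  IsNoetherianRing.of_finite ℤ (MonoidAlgebra ℤ M)

end GlobalDimensionBound

end MonoidGlobalDim

theorem corollaryc (M : Type u) [Monoid M] [Finite M]
    (hreg : MonoidGlobalDim.IsRegularMonoid M) (hap : MonoidGlobalDim.IsAperiodicMonoid M) :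
    MonoidGlobalDim.globalDimension.{u, v} (MonoidAlgebra ℤ M) ≤
        ((3 * MonoidGlobalDim.numJClasses M - 2 : ℕ) : WithBot ℕ∞) ∧
      (∃ N : ℕ, ∀ k : ℕ, N ≤ k → Limits.IsZero
        (MonoidGlobalDim.monoidHomology M (MonoidGlobalDim.trivialModule M) k)) ∧
      ∃ P : ProjectiveResolution (MonoidGlobalDim.trivialModule M),
        (∀ i : ℕ, Module.Finite (MonoidAlgebra ℤ M) (P.complex.X i)) ∧
          ∃ d : ℕ, ∀ i : ℕ, d < i → Limits.IsZero (P.complex.X i) := by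
  have := MonoidGlobalDim.isNoetherianRing_monoidAlgebra (M := M)
  have := MonoidGlobalDim.finite_trivialModule M
  have := (projectiveDimension_le_iff _ _).mp
    (MonoidGlobalDim.projectiveDimension_le_of_regular_aperiodic hreg hap
      (MonoidGlobalDim.trivialModule M))
  obtain ⟨P, hfin, hzero⟩ := MonoidGlobalDim.exists_finite_projectiveResolution
    (3 * MonoidGlobalDim.numJClasses M - 2) (MonoidGlobalDim.trivialModule M)
  exact ⟨iSup_le (MonoidGlobalDim.projectiveDimension_le_of_regular_aperiodic hreg hap),
    -- The threshold is one more than the length bound `3n - 2`: Tor is computed from the same `P`,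
    -- whose terms vanish from there on.
    ⟨_, fun k hk => MonoidGlobalDim.isZero_leftDerived_of_isZero _ P (hzero k hk)⟩,
    P, hfin, _, hzero⟩
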